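/- **Theorem 1.** Let $b>0$, let $\mu\in C^3[0,b]$ with $\mu(0)\neq 0$, and suppose that $m(r)=\int_0^r x^2\mu(x)\,dx$ is strictly increasing on $[0,b]$ and satisfies the no-shell-crossing condition $m'(r)<3m(r)/r$ for $0<r\le b$. Consider the marginally bound collapse of the dust ball of initial radius $b$ and initial density profile $\mu$: the metric is $$ds^2=-dt^2+(R_{,r}\,dr)^2+R^2\,d\Omega^2,\qquad R^3=\tfrac94\,m(r)\,(t_c(r)-t)^2,\qquad t_c(r)=\tfrac23\sqrt{r^3/m(r)},$$ on $0<r\le b$, $0\le t<t_c(r)$ (so that $R_{,t}=-\sqrt{m/R}$ and $R(r,0)=r$), and the central singularity is the boundary point $(r,t)=(0,t_0)$ with $t_0=\lim_{r\to0^+}t_c(r)=\frac23(\mu(0)/3)^{-1/2}$. Call this singularity *(radially) naked* if a future-directed radial null curve (equivalently, up to parametrization, a radial null geodesic) in the region $0<r<b$, $0\le t<t_c(r)$ emanates from it, that is, tends to $(0,t_0)$ in the past; otherwise call it *(radially) censored*. Derivatives at $0$ are one-sided. Exclude the borderline case $\mu'(0)=\mu''(0)=0$, $\mu'''(0)/\mu(0)^{5/2}=-\frac23(26\sqrt3+45)$.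 Then the singularity is naked if and only if one of the following holds: 1. $\mu'(0)<0$; 2. $\mu'(0)=0$ and $\mu''(0)<0$; 3. $\mu'(0)=\mu''(0)=0$ and $\dfrac{\mu'''(0)}{\mu(0)^{5/2}}<-\dfrac23\,(26\sqrt3+45)$. It is censored if and only if $\mu'(0)=\mu''(0)=0$ and $\dfrac{\mu'''(0)}{\mu(0)^{5/2}}>-\dfrac23\,(26\sqrt3+45)$. -/

import Mathlib

/-! Marginally bound spherical dust collapse (units `8πG = c = 1`).  The initial data are the
initial density profile `μ` on `[0, b]`, where `b` is the initial radius of the dust cloud; only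
the values of `μ` on `[0, b]` matter.  At time `t = 0` the areal radius of the shell `r` is `r`. -/

noncomputable section

namespace DustCollapse

/-- The mass function `m(r) = ∫₀^r x² μ(x) dx`. -/
def mass (μ : ℝ → ℝ) (r : ℝ) : ℝ := ∫ x in (0 : ℝ)..r, x ^ 2 * μ x

/-- The no-shell-crossing condition `m_{,r}(r) < 3 m(r) / r` for `0 < r ≤ b`
(the derivative is one-sided at `r = b`). -/
def NoShellCrossing (μ : ℝ → ℝ) (b : ℝ) : Prop :=
  ∀ r ∈ Set.Ioc (0 : ℝ) b, derivWithin (mass μ) (Set.Icc 0 b) r < 3 * mass μ r / r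

/-- The time `t_c(r) = (2/3) √(r³ / m(r))`, `r > 0`, at which the shell `r` collapses to zero
areal radius (shell-focussing singularity). -/
def collapseTime (μ : ℝ → ℝ) (r : ℝ) : ℝ := 2 / 3 * Real.sqrt (r ^ 3 / mass μ r)

/-- The collapse time of the centre, `t₀ = lim_{r → 0⁺} t_c(r) = (2/3) (μ(0)/3)^{-1/2}`. -/
def centralCollapseTime (μ : ℝ → ℝ) : ℝ := 2 / 3 / Real.sqrt (μ 0 / 3)

/-- The areal radius `R(r,t)`, given by `R³ = (9/4) m(r) (t_c(r) - t)²`. -/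
def arealRadius (μ : ℝ → ℝ) (r t : ℝ) : ℝ :=
  (9 / 4 * mass μ r * (collapseTime μ r - t) ^ 2) ^ (1 / 3 : ℝ)

/-- The partial derivative `R_{,r}(r,t)` in the cloud `0 ≤ r ≤ b`. -/
def arealRadiusDr (μ : ℝ → ℝ) (b r t : ℝ) : ℝ :=
  derivWithin (fun x => arealRadius μ x t) (Set.Icc 0 b) r

/-- The line element `ds² = -dt² + (R_{,r} dr)² + R² dΩ²` at the point `(r,t)`, evaluated on a
tangent vector with components `dt`, `dr` and angular length `dΩ` (measured on the unit sphere). -/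
def lineElement (μ : ℝ → ℝ) (b r t dt dr dΩ : ℝ) : ℝ :=
  -dt ^ 2 + (arealRadiusDr μ b r t * dr) ^ 2 + arealRadius μ r t ^ 2 * dΩ ^ 2

/-- `s ↦ (r(s), t(s))`, `0 < s < ε`, is a future-directed radial (`dΩ = 0`) null curve that runs
inside the regular part `0 < r < b`, `0 ≤ t < t_c(r)` of the collapsing cloud.  (A radial null
curve is, up to its parametrization, the same thing as a radial null geodesic.) -/
def IsRadialNullCurve (μ : ℝ → ℝ) (b ε : ℝ) (r t : ℝ → ℝ) : Prop :=
  ∀ s ∈ Set.Ioo (0 : ℝ) ε,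
    r s ∈ Set.Ioo 0 b ∧ 0 ≤ t s ∧ t s < collapseTime μ (r s) ∧
    DifferentiableAt ℝ r s ∧ DifferentiableAt ℝ t s ∧
    0 < deriv t s ∧ lineElement μ b (r s) (t s) (deriv t s) (deriv r s) 0 = 0

/-- The central singularity `(r,t) = (0,t₀)` is (locally, radially) naked: some future-directed
radial null curve emanates from it. -/
def RadiallyNaked (μ : ℝ → ℝ) (b : ℝ) : Prop :=
  ∃ ε > 0, ∃ r t : ℝ → ℝ, IsRadialNullCurve μ b ε r t ∧
    Filter.Tendsto r (nhdsWithin 0 (Set.Ioi 0)) (nhds 0) ∧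
    Filter.Tendsto t (nhdsWithin 0 (Set.Ioi 0)) (nhds (centralCollapseTime μ))

/-- The singularity is (radially) censored: no such curve emanates from it. -/
def RadiallyCensored (μ : ℝ → ℝ) (b : ℝ) : Prop := ¬ RadiallyNaked μ b

/-- The (one-sided) derivative `μ^{(k)}(0)` of the density profile at the centre. -/
def centralDeriv (μ : ℝ → ℝ) (b : ℝ) (k : ℕ) : ℝ :=
  iteratedDerivWithin k μ (Set.Icc 0 b) 0

/-- The critical value `-(2/3)(26√3 + 45)`. -/
def criticalRatio : ℝ := -(2 / 3) * (26 * Real.sqrt 3 + 45)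

/-- The areal radius satisfies the initial condition `R(r,0) = r`. -/
theorem arealRadius_zero (μ : ℝ → ℝ) {r : ℝ} (hr : 0 < r) (hm : 0 < mass μ r) :
    arealRadius μ r 0 = r := by
  unfold arealRadius collapseTime
  have h : 9 / 4 * mass μ r * (2 / 3 * Real.sqrt (r ^ 3 / mass μ r) - 0) ^ 2 = r ^ 3 := by
    rw [sub_zero, mul_pow, Real.sq_sqrt (by positivity)]
    field_simp
    norm_num
  rw [h, ← Real.rpow_natCast, ← Real.rpow_mul hr.le]
  norm_num

/-- The areal radius satisfies the field equation `R_{,t} = -√(m / R)` before collapse. -/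
theorem hasDerivAt_arealRadius (μ : ℝ → ℝ) {r t : ℝ} (hm : 0 < mass μ r)
    (ht : t < collapseTime μ r) :
    HasDerivAt (fun τ => arealRadius μ r τ) (-Real.sqrt (mass μ r / arealRadius μ r t)) t := by
  have hd : 0 < collapseTime μ r - t := sub_pos.2 ht
  have hX : 0 < 9 / 4 * mass μ r * (collapseTime μ r - t) ^ 2 := by positivity
  have h1 : HasDerivAt (fun τ => 9 / 4 * mass μ r * (collapseTime μ r - τ) ^ 2)
      (9 / 4 * mass μ r * (2 * (collapseTime μ r - t) * (-1))) t := by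
    have := (((hasDerivAt_id t).const_sub (collapseTime μ r)).pow 2).const_mul
      (9 / 4 * mass μ r)
    simpa using this
  have h2 := h1.rpow_const (p := (1 / 3 : ℝ)) (Or.inl hX.ne')
  unfold arealRadius
  convert h2 using 1
  set X := 9 / 4 * mass μ r * (collapseTime μ r - t) ^ 2 with hXdef
  have hY : 0 ≤ 3 / 2 * mass μ r * (collapseTime μ r - t) * X ^ (-(2 / 3) : ℝ) := by positivity
  have key : Real.sqrt (mass μ r / X ^ (1 / 3 : ℝ))
      = 3 / 2 * mass μ r * (collapseTime μ r - t) * X ^ (-(2 / 3) : ℝ) := by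
    have e1 : X ^ (-(2 / 3) : ℝ) * X ^ (-(2 / 3) : ℝ) = X⁻¹ * (X ^ (1 / 3 : ℝ))⁻¹ := by
      rw [← Real.rpow_neg hX.le, ← Real.rpow_neg_one, ← Real.rpow_add hX, ← Real.rpow_add hX]
      norm_num
    have e2 : (3 / 2 * mass μ r * (collapseTime μ r - t) * X ^ (-(2 / 3) : ℝ)) ^ 2
        = mass μ r / X ^ (1 / 3 : ℝ) := by
      have e3 : (3 / 2 * mass μ r * (collapseTime μ r - t)) ^ 2 = mass μ r * X := by
        rw [hXdef]; ring
      rw [mul_pow, e3, pow_two, e1, div_eq_mul_inv (mass μ r), mul_assoc, mul_inv_cancel_left₀ hX.ne']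
    rw [← e2, Real.sqrt_sq hY]
  rw [key]
  have : (1 / 3 - 1 : ℝ) = -(2 / 3) := by norm_num
  rw [this]
  ring

end DustCollapse

end

/-!
Write `n = 9m/4`, so that `R³ = n (t_c - t)²`, and use `ξ = ((t_c - t) / n)^{1/3}` in place of `t`.
Everything is governed by the focussing rate `q = dt_c/dn`: one has
`R_{,r} = n_{,r} (ξ²/3 + 2q/(3ξ))` (`arealRadiusDr_eq`), and the outgoing null curves
`dt/dr = R_{,r}` become
`dξ/dr = (n_{,r} / n) (q (3ξ - 2) - ξ³ (3ξ + 1)) / (9 ξ³)`.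
The quotient `ξ³ (3ξ + 1) / (3ξ - 2)` has on `ξ > 2/3` the minimum `A = (52 + 30√3)/27`, attained at
`ξ₀ = (1 + √3)/3`.

If `q > A` near the centre, the right-hand side is negative at `ξ = 2/3` and positive at `ξ = ξ₀`, so
the strip between the two is invariant backwards in `r` and contains a solution down to `r = 0`
(`exists_solution_of_strip`). Since `ξ` stays bounded while `n → 0`, it gives a null curve that
starts at the central singularity (`radiallyNaked_of_lt_rate`).

If `0 ≤ q ≤ θ A` near the centre with `θ < 1`, then `ξ + ((1 - θ)/9) log n` decreases along every
outgoing null curve. On a curve that starts at `r = 0` this forces `ξ → ∞` in the past; but for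
large `ξ` the remaining time `t_c - t` decreases along the curve, so it cannot start from the value
`0` (`not_tendsto_zero_of_rate_le`, `not_radiallyNaked_of_rate_le`).

It remains to compute the limit of `q` at the centre. Up to a factor with a positive limit, `q` is
`(3m - r³μ) / r⁶`, whose numerator is positive by the no-shell-crossing condition and has derivative
`-r³ μ'`. By l'Hôpital's rule the quotient tends to `+∞` if the first nonzero number among `μ'(0)`,
`μ''(0)` is negative, and to `-∞`, which is impossible, if it is positive. If both vanish, `q` tends
to `-(√3/27) μ'''(0) / μ(0)^{5/2}` (`tendsto_focussingRate_of_vanishing`), and comparing this with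
`A` gives the stated threshold (`criticalRate_eq`).
-/

open Filter Topology Set

namespace DustCollapse

/-! ### Backward invariant strips of a scalar differential equation -/

/-- A solution of a scalar equation cannot leave, backwards in the independent variable, a strip
at whose lower edge the field is negative and at whose upper edge it is positive. The solution is
obtained on all of `[r₀, δ]` from the equation whose field is frozen outside the strip. -/
lemma exists_solution_Icc_of_strip {f : ℝ → ℝ → ℝ} {r₀ δ α β : ℝ} (hr₀ : r₀ ≤ δ) (hαβ : α < β)
    (hcont : ∀ x ∈ Icc α β, ContinuousOn (fun r => f r x) (Icc r₀ δ)) {K : NNReal}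
    (hlip : ∀ r ∈ Icc r₀ δ, LipschitzOnWith K (f r) (Icc α β))
    (hα : ∀ r ∈ Icc r₀ δ, f r α < 0) (hβ : ∀ r ∈ Icc r₀ δ, 0 < f r β) :
    ∃ ξ : ℝ → ℝ, ξ δ = α ∧
      ∀ r ∈ Icc r₀ δ, ξ r ∈ Icc α β ∧ HasDerivWithinAt ξ (f r (ξ r)) (Icc r₀ δ) r := by
  have hαmem : α ∈ Icc α β := ⟨le_rfl, hαβ.le⟩
  set F : ℝ → ℝ → ℝ := fun r x => f r (projIcc α β hαβ.le x) with hF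
  have hFlip : ∀ r ∈ Icc r₀ δ, LipschitzWith K (F r) := by
    intro r hr
    have h1 : LipschitzWith (K * 1) (F r) :=
      (hlip r hr).to_restrict.comp (LipschitzWith.projIcc hαβ.le)
    rwa [mul_one] at h1
  obtain ⟨C, hC⟩ := isCompact_Icc.exists_bound_of_continuousOn (hcont α hαmem)
  have hC0 : 0 ≤ C := (norm_nonneg _).trans (hC r₀ ⟨le_rfl, hr₀⟩)
  have hFbound : ∀ r ∈ Icc r₀ δ, ∀ x, ‖F r x‖ ≤ C + K * (β - α) := by
    intro r hr x
    have h1 := (hlip r hr).dist_le_mul _ (projIcc α β hαβ.le x).2 _ hαmem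
    have h2 : dist ((projIcc α β hαβ.le x : Icc α β) : ℝ) α ≤ β - α := by
      rw [Real.dist_eq, abs_of_nonneg (sub_nonneg.2 (projIcc α β hαβ.le x).2.1)]
      linarith [(projIcc α β hαβ.le x).2.2]
    have h3 : ‖F r x - f r α‖ ≤ K * (β - α) := by
      rw [← dist_eq_norm]
      exact h1.trans (mul_le_mul_of_nonneg_left h2 K.2)
    calc ‖F r x‖ = ‖f r α + (F r x - f r α)‖ := by ring_nf
      _ ≤ ‖f r α‖ + ‖F r x - f r α‖ := norm_add_le _ _
      _ ≤ C + K * (β - α) := add_le_add (hC r hr) h3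
  have hL0 : 0 ≤ C + K * (β - α) :=
    add_nonneg hC0 (mul_nonneg K.2 (sub_nonneg.2 hαβ.le))
  set M : NNReal := ⟨C + K * (β - α), hL0⟩
  -- The frozen field is bounded, so the ball may be taken large enough for all of `[r₀, δ]`.
  have hpl : IsPicardLindelof F (⟨δ, hr₀, le_rfl⟩ : Icc r₀ δ) α
      (M * ⟨δ - r₀, sub_nonneg.2 hr₀⟩) 0 M K :=
    { lipschitzOnWith := fun r hr => (hFlip r hr).lipschitzOnWith
      continuousOn := fun x _ => hcont _ (projIcc α β hαβ.le x).2
      norm_le := fun r hr x _ => hFbound r hr x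
      mul_max_le := by
        have : max (δ - δ) (δ - r₀) = δ - r₀ := by
          rw [sub_self]; exact max_eq_right (sub_nonneg.2 hr₀)
        simp only [this, NNReal.coe_zero, sub_zero]
        exact le_rfl }
  obtain ⟨ξ, hξδ, hξ⟩ := hpl.exists_eq_forall_mem_Icc_hasDerivWithinAt₀
  have hξδ' : ξ δ = α := hξδ
  -- The time-reversed solution, whose derivative is controlled on the edges of the strip.
  have hmaps : MapsTo (fun x : ℝ => -x) (Icc (-δ) (-r₀)) (Icc r₀ δ) := fun x hx =>
    ⟨by linarith [hx.2], by linarith [hx.1]⟩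
  have hrev : ∀ x ∈ Icc (-δ) (-r₀),
      HasDerivWithinAt (fun x => ξ (-x)) (-F (-x) (ξ (-x))) (Icc (-δ) (-r₀)) x := by
    intro x hx
    have h1 := (hξ (-x) (hmaps hx)).scomp x (hasDerivAt_neg x).hasDerivWithinAt hmaps
    simpa [Function.comp_def] using h1
  have hrevc : ContinuousOn (fun x => ξ (-x)) (Icc (-δ) (-r₀)) := fun x hx =>
    (hrev x hx).continuousWithinAt
  have hrev' : ∀ x ∈ Ico (-δ) (-r₀),
      HasDerivWithinAt (fun x => ξ (-x)) (-F (-x) (ξ (-x))) (Ici x) x := by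
    intro x hx
    refine (hrev x ⟨hx.1, hx.2.le⟩).mono_of_mem_nhdsWithin ?_
    exact mem_of_superset (Icc_mem_nhdsGE hx.2) (Icc_subset_Icc_left hx.1)
  have hupper : ∀ ⦃x⦄, x ∈ Icc (-δ) (-r₀) → ξ (-x) ≤ β := by
    refine image_le_of_deriv_right_lt_deriv_boundary hrevc hrev' (B := fun _ => β)
      (B' := fun _ => 0) (by simp [hξδ', hαβ.le]) (fun x => hasDerivAt_const x β) ?_
    intro x hx hxβ
    have h1 := hβ (-x) (hmaps ⟨hx.1, hx.2.le⟩)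
    have h2 : F (-x) (ξ (-x)) = f (-x) β := by
      simp only [hF]; rw [show ξ (-x) = β from hxβ, projIcc_right]
    rw [h2]; linarith
  have hlower : ∀ ⦃x⦄, x ∈ Icc (-δ) (-r₀) → -ξ (-x) ≤ -α := by
    refine image_le_of_deriv_right_lt_deriv_boundary hrevc.neg
      (fun x hx => (hrev' x hx).neg) (B := fun _ => -α)
      (B' := fun _ => 0) (by simp [hξδ']) (fun x => hasDerivAt_const x (-α)) ?_
    intro x hx hxα
    have h1 := hα (-x) (hmaps ⟨hx.1, hx.2.le⟩)
    have h2 : F (-x) (ξ (-x)) = f (-x) α := by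
      have : ξ (-x) = α := neg_injective hxα
      simp only [hF]; rw [this, projIcc_left]
    rw [h2]; linarith
  have hmem : ∀ r ∈ Icc r₀ δ, ξ r ∈ Icc α β := by
    intro r hr
    have hr' : -r ∈ Icc (-δ) (-r₀) := ⟨by linarith [hr.2], by linarith [hr.1]⟩
    have h1 := hupper hr'
    have h2 := hlower hr'
    rw [neg_neg] at h1 h2
    exact ⟨by linarith, h1⟩
  refine ⟨ξ, hξδ', fun r hr => ⟨hmem r hr, ?_⟩⟩
  have h1 := hξ r hr
  simp only [hF] at h1
  rwa [projIcc_of_mem hαβ.le (hmem r hr)] at h1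

/-- A strip that is backward invariant on `(0, δ]` contains a solution on all of `(0, δ)`, although
the equation may be singular at `0`. -/
lemma exists_solution_of_strip {f : ℝ → ℝ → ℝ} {δ α β : ℝ} (hαβ : α < β)
    (hcont : ∀ x ∈ Icc α β, ContinuousOn (fun r => f r x) (Ioc 0 δ))
    (hlip : ∀ r₀ > 0, ∃ K : NNReal, ∀ r ∈ Icc r₀ δ, LipschitzOnWith K (f r) (Icc α β))
    (hα : ∀ r ∈ Ioc 0 δ, f r α < 0) (hβ : ∀ r ∈ Ioc 0 δ, 0 < f r β) :
    ∃ ξ : ℝ → ℝ, ∀ r ∈ Ioo 0 δ, ξ r ∈ Icc α β ∧ HasDerivAt ξ (f r (ξ r)) r := by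
  have hsub : ∀ {r₀ : ℝ}, 0 < r₀ → Icc r₀ δ ⊆ Ioc 0 δ := fun h r hr => ⟨h.trans_le hr.1, hr.2⟩
  have hex : ∀ r₀ : ℝ, ∃ ξ : ℝ → ℝ, r₀ ∈ Ioc 0 δ → ξ δ = α ∧
      ∀ r ∈ Icc r₀ δ, ξ r ∈ Icc α β ∧ HasDerivWithinAt ξ (f r (ξ r)) (Icc r₀ δ) r := by
    intro r₀
    by_cases hr₀ : r₀ ∈ Ioc 0 δ
    · obtain ⟨K, hK⟩ := hlip r₀ hr₀.1
      obtain ⟨ξ, hξ⟩ := exists_solution_Icc_of_strip hr₀.2 hαβ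
        (fun x hx => (hcont x hx).mono (hsub hr₀.1)) hK
        (fun r hr => hα r (hsub hr₀.1 hr)) (fun r hr => hβ r (hsub hr₀.1 hr))
      exact ⟨ξ, fun _ => hξ⟩
    · exact ⟨fun _ => 0, fun h => absurd h hr₀⟩
  choose Ξ hΞ using hex
  have huniq : ∀ {r₀ r₁ : ℝ}, 0 < r₀ → r₀ ≤ r₁ → r₁ ≤ δ → EqOn (Ξ r₀) (Ξ r₁) (Icc r₁ δ) := by
    intro r₀ r₁ h0 h01 h1
    obtain ⟨K, hK⟩ := hlip r₁ (h0.trans_le h01)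
    have A := hΞ r₀ ⟨h0, h01.trans h1⟩
    have B := hΞ r₁ ⟨h0.trans_le h01, h1⟩
    have A' : ∀ r ∈ Icc r₁ δ, HasDerivWithinAt (Ξ r₀) (f r (Ξ r₀ r)) (Icc r₁ δ) r := fun r hr =>
      (A.2 r ⟨h01.trans hr.1, hr.2⟩).2.mono (Icc_subset_Icc_left h01)
    have hnhds : ∀ r ∈ Ioc r₁ δ, Icc r₁ δ ∈ 𝓝[≤] r := fun r hr =>
      mem_of_superset (Icc_mem_nhdsLE hr.1) (Icc_subset_Icc_right hr.2)
    exact ODE_solution_unique_of_mem_Icc_left (v := f) (s := fun _ => Icc α β) (K := K)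
      (fun r hr => hK r ⟨hr.1.le, hr.2⟩)
      (fun r hr => (A' r hr).continuousWithinAt)
      (fun r hr => (A' r ⟨hr.1.le, hr.2⟩).mono_of_mem_nhdsWithin (hnhds r hr))
      (fun r hr => (A.2 r ⟨h01.trans hr.1.le, hr.2⟩).1)
      (fun r hr => (B.2 r hr).2.continuousWithinAt)
      (fun r hr => (B.2 r ⟨hr.1.le, hr.2⟩).2.mono_of_mem_nhdsWithin (hnhds r hr))
      (fun r hr => (B.2 r ⟨hr.1.le, hr.2⟩).1) (A.1.trans B.1.symm)
  refine ⟨fun r => Ξ r r, fun r hr => ⟨((hΞ r ⟨hr.1, hr.2.le⟩).2 r ⟨le_rfl, hr.2.le⟩).1, ?_⟩⟩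
  have hr2 : 0 < r / 2 := half_pos hr.1
  have hlt : r / 2 < r := half_lt_self hr.1
  have h1 : HasDerivAt (Ξ (r / 2)) (f r (Ξ (r / 2) r)) r :=
    ((hΞ (r / 2) ⟨hr2, (hlt.trans hr.2).le⟩).2 r ⟨hlt.le, hr.2.le⟩).2.hasDerivAt
      (Icc_mem_nhds hlt hr.2)
  rw [huniq hr2 hlt.le hr.2.le ⟨le_rfl, hr.2.le⟩] at h1
  refine h1.congr_of_eventuallyEq ?_
  filter_upwards [Ioo_mem_nhds hlt hr.2] with x hx
  exact (huniq hr2 hx.1.le hx.2.le ⟨le_rfl, hx.2.le⟩).symm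

/-! ### Derivatives of the mass, the collapse time and the areal radius -/

/-- The rate `dt_c / d(9m/4)` at which the collapse time grows with (a multiple of) the mass. -/
noncomputable def focussingRate (μ : ℝ → ℝ) (r : ℝ) : ℝ :=
  4 / 27 * Real.sqrt (mass μ r / r ^ 3) * (3 * mass μ r - r ^ 3 * μ r) / (mass μ r ^ 2 * μ r)

lemma hasDerivAt_mass {μ : ℝ → ℝ} {b r : ℝ} (hμ : ContinuousOn μ (Icc 0 b)) (hr : r ∈ Ioo 0 b) :
    HasDerivAt (mass μ) (r ^ 2 * μ r) r := by
  have hc : ContinuousOn (fun x : ℝ => x ^ 2 * μ x) (Icc 0 b) := by fun_prop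
  have hnhds : Icc 0 b ∈ 𝓝 r := Icc_mem_nhds hr.1 hr.2
  refine intervalIntegral.integral_hasDerivAt_right ?_ ?_ (hc.continuousAt hnhds)
  · refine ContinuousOn.intervalIntegrable (hc.mono ?_)
    rw [uIcc_of_le hr.1.le]
    exact Icc_subset_Icc_right hr.2.le
  · exact (hc.mono Ioo_subset_Icc_self).stronglyMeasurableAtFilter isOpen_Ioo r hr

lemma hasDerivAt_collapseTime {μ : ℝ → ℝ} {b r : ℝ} (hμ : ContinuousOn μ (Icc 0 b))
    (hr : r ∈ Ioo 0 b) (hm : 0 < mass μ r) (hμr : 0 < μ r) :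
    HasDerivAt (collapseTime μ) (focussingRate μ r * (9 / 4 * (r ^ 2 * μ r))) r := by
  have hr0 : 0 < r := hr.1
  have hX : 0 < r ^ 3 / mass μ r := by positivity
  have h1 := (((hasDerivAt_pow 3 r).div (hasDerivAt_mass hμ hr) hm.ne').sqrt hX.ne').const_mul
    (2 / 3 : ℝ)
  refine h1.congr_deriv ?_
  have h2 : Real.sqrt (mass μ r / r ^ 3) = (Real.sqrt (r ^ 3 / mass μ r))⁻¹ := by
    rw [← Real.sqrt_inv, inv_div]
  have h3 : Real.sqrt (r ^ 3 / mass μ r) ≠ 0 := (Real.sqrt_pos.2 hX).ne'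
  unfold focussingRate
  simp only [Pi.div_apply]
  rw [h2]
  generalize Real.sqrt (r ^ 3 / mass μ r) = S at h3
  field_simp
  ring

lemma rpow_one_third_sub_one {x : ℝ} (hx : 0 < x) : (x ^ 3) ^ (1 / 3 - 1 : ℝ) = (x ^ 2)⁻¹ := by
  rw [← Real.rpow_natCast x 3, ← Real.rpow_mul hx.le, ← Real.rpow_natCast x 2,
    ← Real.rpow_neg hx.le]
  norm_num

/-- With `n = 9m/4` and `ξ = ((t_c - t) / n)^{1/3}` one has `R = n ξ²` and
`R_{,r} = n_{,r} (ξ² / 3 + 2 q / (3 ξ))`, where `q` is the focussing rate. -/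
lemma arealRadiusDr_eq {μ : ℝ → ℝ} {b r t ξ : ℝ} (hμ : ContinuousOn μ (Icc 0 b))
    (hr : r ∈ Ioo 0 b) (hm : 0 < mass μ r) (hμr : 0 < μ r) (hξ : 0 < ξ)
    (hξt : collapseTime μ r - t = ξ ^ 3 * (9 / 4 * mass μ r)) :
    arealRadiusDr μ b r t =
      9 / 4 * (r ^ 2 * μ r) * (ξ ^ 2 / 3 + 2 * focussingRate μ r / (3 * ξ)) := by
  set n : ℝ := 9 / 4 * mass μ r with hn
  have hn0 : 0 < n := by positivity
  have hX : 9 / 4 * mass μ r * (collapseTime μ r - t) ^ 2 = (n * ξ ^ 2) ^ 3 := by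
    rw [hξt, ← hn]; ring
  have hXpos : 0 < n * ξ ^ 2 := by positivity
  have h1 : HasDerivAt (fun x => 9 / 4 * mass μ x * (collapseTime μ x - t) ^ 2)
      (9 / 4 * (r ^ 2 * μ r) * (collapseTime μ r - t) ^ 2 + 9 / 4 * mass μ r *
        (2 * (collapseTime μ r - t) * (focussingRate μ r * (9 / 4 * (r ^ 2 * μ r))))) r := by
    have := ((hasDerivAt_mass hμ hr).const_mul (9 / 4 : ℝ)).mul
      (((hasDerivAt_collapseTime hμ hr hm hμr).sub_const t).pow 2)
    simpa [Pi.mul_def, Pi.pow_def] using this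
  have h2 := h1.rpow_const (p := (1 / 3 : ℝ)) (Or.inl (by rw [hX]; positivity))
  unfold arealRadiusDr
  rw [show (fun x => arealRadius μ x t) =
    fun x => (9 / 4 * mass μ x * (collapseTime μ x - t) ^ 2) ^ (1 / 3 : ℝ) from rfl,
    derivWithin_of_mem_nhds (Icc_mem_nhds hr.1 hr.2), h2.deriv, hX]
  rw [rpow_one_third_sub_one hXpos, hξt, ← hn]
  field_simp

/-! ### The threshold of the focussing rate -/

/-- The minimum `(52 + 30√3)/27` of `ξ³ (3ξ + 1) / (3ξ - 2)` over `ξ > 2/3`. -/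
noncomputable def criticalRate : ℝ := (52 + 30 * Real.sqrt 3) / 27

lemma criticalRate_pos : 0 < criticalRate := by unfold criticalRate; positivity

/-- The point at which `ξ³ (3ξ + 1) / (3ξ - 2)` is minimal on `ξ > 2/3`. -/
noncomputable def criticalPoint : ℝ := (1 + Real.sqrt 3) / 3

lemma two_thirds_lt_criticalPoint : 2 / 3 < criticalPoint := by
  have h : 1 < Real.sqrt 3 := by rw [Real.lt_sqrt] <;> norm_num
  unfold criticalPoint; linarith

/-- The difference of the two sides has a double zero at the critical point. -/
lemma criticalRate_identity (ξ : ℝ) :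
    ξ ^ 3 * (3 * ξ + 1) - criticalRate * (3 * ξ - 2) = (ξ - criticalPoint) ^ 2 *
      (3 * ξ ^ 2 + (3 + 2 * Real.sqrt 3) * ξ + (14 + 8 * Real.sqrt 3) / 3) := by
  have h : Real.sqrt 3 ^ 2 = 3 := Real.sq_sqrt (by norm_num)
  unfold criticalRate criticalPoint
  generalize Real.sqrt 3 = s at h
  have h3 : s ^ 3 = 3 * s := by rw [pow_succ, h]
  ring_nf
  simp only [h, h3]
  ring

lemma criticalRate_mul_le {ξ : ℝ} (hξ : 0 ≤ ξ) :
    criticalRate * (3 * ξ - 2) ≤ ξ ^ 3 * (3 * ξ + 1) := by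
  have h := criticalRate_identity ξ
  have : 0 ≤ (ξ - criticalPoint) ^ 2 *
      (3 * ξ ^ 2 + (3 + 2 * Real.sqrt 3) * ξ + (14 + 8 * Real.sqrt 3) / 3) := by positivity
  linarith

lemma criticalRate_mul_criticalPoint :
    criticalRate * (3 * criticalPoint - 2) = criticalPoint ^ 3 * (3 * criticalPoint + 1) := by
  have h := criticalRate_identity criticalPoint
  rw [sub_self, zero_pow two_ne_zero, zero_mul] at h
  linarith

/-! ### Below the threshold no null curve emanates -/

lemma nonpos_of_antitoneOn_of_tendsto {y : ℝ → ℝ} {ε s : ℝ} (hy : AntitoneOn y (Ioo 0 ε))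
    (hlim : Tendsto y (𝓝[>] 0) (𝓝 0)) (hs : s ∈ Ioo 0 ε) : y s ≤ 0 := by
  refine ge_of_tendsto hlim ?_
  filter_upwards [Ioo_mem_nhdsGT hs.1] with x hx
  exact hy ⟨hx.1, hx.2.trans hs.2⟩ hs hx.2.le

lemma antitoneOn_Ioo_of_hasDerivAt {y y' : ℝ → ℝ} {a c : ℝ}
    (hy : ∀ s ∈ Ioo a c, HasDerivAt y (y' s) s) (hy' : ∀ s ∈ Ioo a c, y' s ≤ 0) :
    AntitoneOn y (Ioo a c) := by
  refine antitoneOn_of_deriv_nonpos (convex_Ioo a c)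
    (fun s hs => (hy s hs).continuousAt.continuousWithinAt) ?_ ?_
  · rw [interior_Ioo]
    exact fun s hs => (hy s hs).differentiableAt.differentiableWithinAt
  · rw [interior_Ioo]
    exact fun s hs => (hy s hs).deriv ▸ hy' s hs

/-- The equation of the outgoing null curves for `n = 9m/4` and `y = t_c - t = ξ³ n` has no
solution that reaches `n = y = 0` if the focussing rate `Q` stays below the threshold: `ξ` grows
without bound in the past, at least like a multiple of `-log n`, but for large `ξ` the
time `y` left to collapse decreases along the curve. -/
lemma not_tendsto_zero_of_rate_le {n y p Q ξ : ℝ → ℝ} {ε θ : ℝ} (hε : 0 < ε) (hθ : θ < 1)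
    (hn : ∀ s ∈ Ioo 0 ε, 0 < n s) (hξ : ∀ s ∈ Ioo 0 ε, 0 < ξ s)
    (hy : ∀ s ∈ Ioo 0 ε, y s = ξ s ^ 3 * n s) (hp : ∀ s ∈ Ioo 0 ε, 0 < p s)
    (hQ0 : ∀ s ∈ Ioo 0 ε, 0 ≤ Q s) (hQ : ∀ s ∈ Ioo 0 ε, Q s ≤ θ * criticalRate)
    (hn' : ∀ s ∈ Ioo 0 ε, HasDerivAt n (p s) s)
    (hy' : ∀ s ∈ Ioo 0 ε,
      HasDerivAt y (p s * (Q s - (ξ s ^ 2 / 3 + 2 * Q s / (3 * ξ s)))) s)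
    (hnlim : Tendsto n (𝓝[>] 0) (𝓝 0)) (hylim : Tendsto y (𝓝[>] 0) (𝓝 0)) : False := by
  have hξ' : ∀ s ∈ Ioo 0 ε, HasDerivAt ξ
      (p s / n s * (Q s * (3 * ξ s - 2) - ξ s ^ 3 * (3 * ξ s + 1)) / (9 * ξ s ^ 3)) s := by
    intro s hs
    have hns := hn s hs
    have hξs := hξ s hs
    have h1 := ((hy' s hs).div (hn' s hs) hns.ne').rpow_const (p := (1 / 3 : ℝ))
      (Or.inl (by
        simp only [Pi.div_apply]
        rw [hy s hs]; positivity))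
    have h2 : ∀ x ∈ Ioo 0 ε, (y / n) x = ξ x ^ 3 := by
      intro x hx
      have := (hn x hx).ne'
      simp only [Pi.div_apply]
      rw [hy x hx]; field_simp
    have h3 : ξ =ᶠ[𝓝 s] fun x => (y / n) x ^ (1 / 3 : ℝ) := by
      filter_upwards [Ioo_mem_nhds hs.1 hs.2] with x hx
      rw [h2 x hx, ← Real.rpow_natCast, ← Real.rpow_mul (hξ x hx).le]
      norm_num
    refine (h1.congr_of_eventuallyEq h3).congr_deriv ?_
    rw [h2 s hs, rpow_one_third_sub_one hξs, hy s hs]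
    field_simp
    ring
  set κ : ℝ := (1 - θ) / 9 with hκ
  have hκ0 : 0 < κ := by rw [hκ]; linarith
  have hξ'le : ∀ s ∈ Ioo 0 ε,
      p s / n s * (Q s * (3 * ξ s - 2) - ξ s ^ 3 * (3 * ξ s + 1)) / (9 * ξ s ^ 3)
        + κ * (p s / n s) ≤ 0 := by
    intro s hs
    have hξs := hξ s hs
    have hpn : 0 < p s / n s := div_pos (hp s hs) (hn s hs)
    have hc := criticalRate_mul_le hξs.le
    have h3 : 0 < ξ s ^ 3 := by positivity
    have h4 : 0 < ξ s ^ 3 * (3 * ξ s) := by positivity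
    have key : Q s * (3 * ξ s - 2) ≤ θ * (ξ s ^ 3 * (3 * ξ s + 1)) := by
      have hθ0 : 0 ≤ θ := by
        by_contra h
        have := mul_neg_of_neg_of_pos (not_le.1 h) criticalRate_pos
        linarith [hQ0 s hs, hQ s hs]
      rcases le_total (3 * ξ s - 2) 0 with h | h
      · have h5 : Q s * (3 * ξ s - 2) ≤ 0 := mul_nonpos_of_nonneg_of_nonpos (hQ0 s hs) h
        have h6 : 0 ≤ θ * (ξ s ^ 3 * (3 * ξ s + 1)) := by positivity
        linarith
      · calc Q s * (3 * ξ s - 2) ≤ θ * criticalRate * (3 * ξ s - 2) :=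
              mul_le_mul_of_nonneg_right (hQ s hs) h
          _ = θ * (criticalRate * (3 * ξ s - 2)) := by ring
          _ ≤ _ := mul_le_mul_of_nonneg_left hc hθ0
    have h7 : (Q s * (3 * ξ s - 2) - ξ s ^ 3 * (3 * ξ s + 1)) / (9 * ξ s ^ 3) + κ ≤ 0 := by
      rw [div_add' _ _ _ (by positivity)]
      refine div_nonpos_of_nonpos_of_nonneg ?_ (by positivity)
      have : 0 ≤ (1 - θ) * (ξ s ^ 3 * (3 * ξ s)) := mul_nonneg (by linarith) h4.le
      rw [hκ]
      nlinarith
    have h8 := mul_nonpos_of_nonneg_of_nonpos hpn.le h7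
    calc _ = p s / n s * ((Q s * (3 * ξ s - 2) - ξ s ^ 3 * (3 * ξ s + 1)) / (9 * ξ s ^ 3) + κ) := by
            ring
      _ ≤ 0 := h8
  have hanti : AntitoneOn (fun s => ξ s + κ * Real.log (n s)) (Ioo 0 ε) :=
    antitoneOn_Ioo_of_hasDerivAt
      (fun s hs => (hξ' s hs).add (((hn' s hs).log (hn s hs).ne').const_mul κ)) hξ'le
  have hmem : Ioo 0 ε ∈ 𝓝[>] (0 : ℝ) := Ioo_mem_nhdsGT hε
  have hlog : Tendsto (fun s => Real.log (n s)) (𝓝[>] 0) atBot := by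
    refine Real.tendsto_log_nhdsGT_zero.comp (tendsto_nhdsWithin_iff.2 ⟨hnlim, ?_⟩)
    filter_upwards [hmem] with s hs using hn s hs
  have hε2 : ε / 2 ∈ Ioo 0 ε := ⟨half_pos hε, half_lt_self hε⟩
  have hξlim : Tendsto ξ (𝓝[>] 0) atTop := by
    have h1 : Tendsto (fun s => (ξ (ε / 2) + κ * Real.log (n (ε / 2))) + (-κ) * Real.log (n s))
        (𝓝[>] 0) atTop :=
      tendsto_atTop_add_const_left _ _ (hlog.const_mul_atBot_of_neg (neg_lt_zero.2 hκ0))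
    refine tendsto_atTop_mono' _ ?_ h1
    filter_upwards [Ioo_mem_nhdsGT hε2.1] with s hs
    have := hanti ⟨hs.1, hs.2.trans hε2.2⟩ hε2 hs.2.le
    simp only at this
    linarith
  have hev : ∀ᶠ s in 𝓝[>] (0 : ℝ), s ∈ Ioo 0 ε ∧ 1 + 3 * (θ * criticalRate) ≤ ξ s ∧ 1 ≤ ξ s := by
    filter_upwards [hmem, hξlim.eventually_ge_atTop (1 + 3 * (θ * criticalRate)),
      hξlim.eventually_ge_atTop 1] with s h1 h2 h3 using ⟨h1, h2, h3⟩
  obtain ⟨ε', hε', hsub⟩ := (mem_nhdsGT_iff_exists_Ioo_subset).1 hev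
  have hyanti : AntitoneOn y (Ioo 0 ε') := by
    refine antitoneOn_Ioo_of_hasDerivAt (fun s hs => hy' s (hsub hs).1) ?_
    intro s hs
    obtain ⟨h1, h2, h3⟩ := hsub hs
    refine mul_nonpos_of_nonneg_of_nonpos (hp s h1).le ?_
    have h4 : 0 ≤ 2 * Q s / (3 * ξ s) :=
      div_nonneg (mul_nonneg zero_le_two (hQ0 s h1)) (by linarith)
    have h5 : ξ s ≤ ξ s ^ 2 := by nlinarith
    linarith [hQ s h1]
  have hε'' : (0 : ℝ) < ε' := hε'
  have hε'2 : ε' / 2 ∈ Ioo 0 ε' := ⟨half_pos hε'', half_lt_self hε''⟩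
  have h1 := nonpos_of_antitoneOn_of_tendsto hyanti hylim hε'2
  have h2 := (hsub hε'2).1
  rw [hy _ h2] at h1
  have := hn _ h2
  have := hξ _ h2
  exact absurd h1 (not_le.2 (by positivity))

/-- A null curve from the central singularity is outgoing by Darboux's theorem, and an outgoing one
cannot exist while the focussing rate stays below the threshold. -/
lemma not_radiallyNaked_of_rate_le {μ : ℝ → ℝ} {b δ θ : ℝ} (hμ : ContinuousOn μ (Icc 0 b))
    (hδ : 0 < δ) (hθ : θ < 1)
    (hm : ∀ r ∈ Ioc 0 δ, 0 < mass μ r) (hμpos : ∀ r ∈ Ioc 0 δ, 0 < μ r)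
    (hq0 : ∀ r ∈ Ioc 0 δ, 0 ≤ focussingRate μ r)
    (hq : ∀ r ∈ Ioc 0 δ, focussingRate μ r ≤ θ * criticalRate)
    (hmlim : Tendsto (mass μ) (𝓝[>] 0) (𝓝 0))
    (hTlim : Tendsto (collapseTime μ) (𝓝[>] 0) (𝓝 (centralCollapseTime μ))) :
    ¬ RadiallyNaked μ b := by
  rintro ⟨ε₀, hε₀, r, t, hcurve, hrlim, htlim⟩
  have hev : ∀ᶠ s in 𝓝[>] (0 : ℝ), s ∈ Ioo 0 ε₀ ∧ r s ∈ Ioc 0 δ := by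
    filter_upwards [Ioo_mem_nhdsGT hε₀, hrlim.eventually (gt_mem_nhds hδ)] with s h1 h2
    exact ⟨h1, (hcurve s h1).1.1, le_of_lt h2⟩
  obtain ⟨ε, hε, hsub⟩ := mem_nhdsGT_iff_exists_Ioo_subset.1 hev
  have hε0 : (0 : ℝ) < ε := hε
  have hr : ∀ s ∈ Ioo 0 ε, HasDerivAt r (deriv r s) s := fun s hs =>
    (hcurve s (hsub hs).1).2.2.2.1.hasDerivAt
  have ht : ∀ s ∈ Ioo 0 ε, HasDerivAt t (deriv t s) s := fun s hs =>
    (hcurve s (hsub hs).1).2.2.2.2.1.hasDerivAt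
  have ht' : ∀ s ∈ Ioo 0 ε, 0 < deriv t s := fun s hs => (hcurve s (hsub hs).1).2.2.2.2.2.1
  have hnull : ∀ s ∈ Ioo 0 ε, deriv t s ^ 2 = (arealRadiusDr μ b (r s) (t s) * deriv r s) ^ 2 := by
    intro s hs
    have := (hcurve s (hsub hs).1).2.2.2.2.2.2
    unfold lineElement at this
    linarith
  have hr'ne : ∀ s ∈ Ioo 0 ε, deriv r s ≠ 0 := by
    intro s hs h
    have h1 := hnull s hs
    rw [h, mul_zero] at h1
    nlinarith [ht' s hs]
  have hmid : ε / 2 ∈ Ioo 0 ε := ⟨half_pos hε0, half_lt_self hε0⟩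
  have hr'pos : ∀ s ∈ Ioo 0 ε, 0 < deriv r s := by
    refine (hasDerivWithinAt_forall_lt_or_forall_gt_of_forall_ne (convex_Ioo 0 ε)
      (fun s hs => (hr s hs).hasDerivWithinAt) hr'ne).resolve_left ?_
    -- Along an ingoing curve `r` would decrease, so it could not start from `0`.
    intro hneg
    have h1 := nonpos_of_antitoneOn_of_tendsto
      (antitoneOn_Ioo_of_hasDerivAt hr (fun s hs => (hneg s hs).le)) hrlim hmid
    exact absurd (hsub hmid).2.1 (not_lt.2 h1)
  have hrlim' : Tendsto r (𝓝[>] 0) (𝓝[>] 0) := by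
    refine tendsto_nhdsWithin_iff.2 ⟨hrlim, ?_⟩
    filter_upwards [hev] with s hs using hs.2.1
  have hnpos : ∀ s ∈ Ioo 0 ε, 0 < 9 / 4 * mass μ (r s) := fun s hs =>
    mul_pos (by norm_num) (hm _ (hsub hs).2)
  have hypos : ∀ s ∈ Ioo 0 ε, 0 < collapseTime μ (r s) - t s := fun s hs =>
    sub_pos.2 (hcurve s (hsub hs).1).2.2.1
  set ξ : ℝ → ℝ := fun s =>
    ((collapseTime μ (r s) - t s) / (9 / 4 * mass μ (r s))) ^ (1 / 3 : ℝ) with hξdef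
  have hξ : ∀ s ∈ Ioo 0 ε, 0 < ξ s := fun s hs =>
    Real.rpow_pos_of_pos (div_pos (hypos s hs) (hnpos s hs)) _
  have hξy : ∀ s ∈ Ioo 0 ε,
      collapseTime μ (r s) - t s = ξ s ^ 3 * (9 / 4 * mass μ (r s)) := by
    intro s hs
    have h1 : ξ s ^ 3 = (collapseTime μ (r s) - t s) / (9 / 4 * mass μ (r s)) := by
      rw [hξdef, ← Real.rpow_natCast, ← Real.rpow_mul (div_pos (hypos s hs) (hnpos s hs)).le]
      norm_num
    rw [h1, div_mul_cancel₀ _ (hnpos s hs).ne']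
  have hrmem : ∀ s ∈ Ioo 0 ε, r s ∈ Ioo 0 b := fun s hs => (hcurve s (hsub hs).1).1
  refine not_tendsto_zero_of_rate_le (n := fun s => 9 / 4 * mass μ (r s))
    (y := fun s => collapseTime μ (r s) - t s)
    (p := fun s => 9 / 4 * (r s ^ 2 * μ (r s)) * deriv r s)
    (Q := fun s => focussingRate μ (r s)) hε0 hθ hnpos hξ hξy ?_
    (fun s hs => hq0 _ (hsub hs).2) (fun s hs => hq _ (hsub hs).2) ?_ ?_ ?_ ?_
  · intro s hs
    have h1 := hμpos _ (hsub hs).2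
    have h2 := (hsub hs).2.1
    have h3 := hr'pos s hs
    positivity
  · intro s hs
    have h1 := ((hasDerivAt_mass hμ (hrmem s hs)).comp s (hr s hs)).const_mul (9 / 4 : ℝ)
    exact h1.congr_deriv (by ring)
  · intro s hs
    have hD := (hsub hs).2
    have h1 := ((hasDerivAt_collapseTime hμ (hrmem s hs) (hm _ hD) (hμpos _ hD)).comp s
      (hr s hs)).sub (ht s hs)
    refine h1.congr_deriv ?_
    have hRr := arealRadiusDr_eq hμ (hrmem s hs) (hm _ hD) (hμpos _ hD) (hξ s hs) (hξy s hs)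
    have hRrpos : 0 < arealRadiusDr μ b (r s) (t s) := by
      rw [hRr]
      have h1 := hμpos _ hD
      have h2 := hD.1
      have h3 := hξ s hs
      have h4 := hq0 _ hD
      positivity
    have h2 : deriv t s = arealRadiusDr μ b (r s) (t s) * deriv r s :=
      (pow_left_inj₀ (ht' s hs).le (mul_pos hRrpos (hr'pos s hs)).le two_ne_zero).1 (hnull s hs)
    rw [h2, hRr]
    ring
  · simpa using (hmlim.comp hrlim').const_mul (9 / 4 : ℝ)
  · simpa using (hTlim.comp hrlim').sub htlim

/-! ### Above the threshold a null curve emanates -/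

/-- The right-hand side `n_{,r} / n · (q (3ξ - 2) - ξ³ (3ξ + 1)) / (9 ξ³)` of the equation of the
outgoing null curves, for `ξ = ((t_c - t) / n)^{1/3}` as a function of `r`. -/
noncomputable def nullField (μ : ℝ → ℝ) (r ξ : ℝ) : ℝ :=
  r ^ 2 * μ r / mass μ r *
    (focussingRate μ r * ((3 * ξ - 2) / (9 * ξ ^ 3)) - (3 * ξ + 1) / 9)

lemma nullField_two_thirds_neg {μ : ℝ → ℝ} {r : ℝ} (hr : 0 < r) (hm : 0 < mass μ r)
    (hμr : 0 < μ r) : nullField μ r (2 / 3) < 0 := by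
  have : 0 < r ^ 2 * μ r / mass μ r := by positivity
  unfold nullField
  norm_num
  linarith

lemma nullField_criticalPoint_pos {μ : ℝ → ℝ} {r : ℝ} (hr : 0 < r) (hm : 0 < mass μ r)
    (hμr : 0 < μ r) (hq : criticalRate < focussingRate μ r) :
    0 < nullField μ r criticalPoint := by
  have h1 : 0 < r ^ 2 * μ r / mass μ r := by positivity
  have h2 := two_thirds_lt_criticalPoint
  have h3 : 0 < criticalPoint := by linarith
  have h4 := mul_lt_mul_of_pos_right hq (show 0 < 3 * criticalPoint - 2 by linarith)
  rw [criticalRate_mul_criticalPoint] at h4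
  refine mul_pos h1 ?_
  have h5 : focussingRate μ r * ((3 * criticalPoint - 2) / (9 * criticalPoint ^ 3)) -
      (3 * criticalPoint + 1) / 9 = (focussingRate μ r * (3 * criticalPoint - 2) -
        criticalPoint ^ 3 * (3 * criticalPoint + 1)) / (9 * criticalPoint ^ 3) := by
    field_simp
  rw [h5]
  exact div_pos (by linarith) (by positivity)

lemma exists_nullField_solution {μ : ℝ → ℝ} {b δ : ℝ} (hμ : ContinuousOn μ (Icc 0 b))
    (hδb : δ < b) (hm : ∀ r ∈ Ioc 0 δ, 0 < mass μ r) (hμpos : ∀ r ∈ Ioc 0 δ, 0 < μ r)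
    (hq : ∀ r ∈ Ioc 0 δ, criticalRate < focussingRate μ r) :
    ∃ ξ : ℝ → ℝ, ∀ r ∈ Ioo 0 δ,
      ξ r ∈ Icc (2 / 3) criticalPoint ∧ HasDerivAt ξ (nullField μ r (ξ r)) r := by
  have hsub : Ioc 0 δ ⊆ Ioo 0 b := fun r hr => ⟨hr.1, hr.2.trans_lt hδb⟩
  have hμc : ContinuousOn μ (Ioc 0 δ) := hμ.mono (hsub.trans Ioo_subset_Icc_self)
  have hmc : ContinuousOn (mass μ) (Ioc 0 δ) := fun r hr =>
    (hasDerivAt_mass hμ (hsub hr)).continuousAt.continuousWithinAt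
  have hr0 : ∀ r ∈ Ioc 0 δ, r ^ 3 ≠ 0 := fun r hr => (pow_pos hr.1 3).ne'
  have huc : ContinuousOn (fun r => r ^ 2 * μ r / mass μ r) (Ioc 0 δ) :=
    ContinuousOn.div (by fun_prop) hmc fun r hr => (hm r hr).ne'
  have hqc : ContinuousOn (focussingRate μ) (Ioc 0 δ) := by
    refine ContinuousOn.div ?_ (by fun_prop)
      fun r hr => (mul_pos (pow_pos (hm r hr) 2) (hμpos r hr)).ne'
    exact (continuousOn_const.mul (hmc.div (by fun_prop) hr0).sqrt).mul (by fun_prop)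
  refine exists_solution_of_strip two_thirds_lt_criticalPoint ?_ ?_
    (fun r hr => nullField_two_thirds_neg hr.1 (hm r hr) (hμpos r hr))
    (fun r hr => nullField_criticalPoint_pos hr.1 (hm r hr) (hμpos r hr) (hq r hr))
  · intro x _
    exact huc.mul ((hqc.mul continuousOn_const).sub continuousOn_const)
  · intro r₀ hr₀
    have hss : Icc r₀ δ ⊆ Ioc 0 δ := fun r hr => ⟨hr₀.trans_le hr.1, hr.2⟩
    obtain ⟨C₁, hC₁⟩ := isCompact_Icc.exists_bound_of_continuousOn ((huc.mul hqc).mono hss)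
    obtain ⟨C₂, hC₂⟩ := isCompact_Icc.exists_bound_of_continuousOn (huc.mono hss)
    have hA : ContDiffOn ℝ 1 (fun x : ℝ => (3 * x - 2) / (9 * x ^ 3))
        (Icc (2 / 3) criticalPoint) := by
      refine ContDiffOn.div (by fun_prop) (by fun_prop) fun x hx => ?_
      have : 0 < x := by linarith [hx.1]
      positivity
    obtain ⟨K, hK⟩ := hA.exists_lipschitzOnWith one_ne_zero (convex_Icc _ _) isCompact_Icc
    refine ⟨(|C₁| * K + |C₂|).toNNReal, fun r hr => LipschitzOnWith.of_dist_le_mul ?_⟩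
    intro x hx y hy
    rw [Real.coe_toNNReal _ (by positivity)]
    have h1 := hK.dist_le_mul x hx y hy
    have h2 := (hC₁ r hr).trans (le_abs_self _)
    have h3 := (hC₂ r hr).trans (le_abs_self _)
    rw [Real.dist_eq] at h1 ⊢
    rw [Real.norm_eq_abs] at h2 h3
    have h4 : nullField μ r x - nullField μ r y =
        r ^ 2 * μ r / mass μ r * focussingRate μ r *
          ((3 * x - 2) / (9 * x ^ 3) - (3 * y - 2) / (9 * y ^ 3))
        - r ^ 2 * μ r / mass μ r * ((x - y) / 3) := by
      unfold nullField; ring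
    rw [h4]
    refine (abs_sub _ _).trans ?_
    rw [abs_mul (_ * focussingRate μ r), abs_mul _ ((x - y) / 3), add_mul, Real.dist_eq]
    refine add_le_add ?_ ?_
    · rw [mul_assoc]
      exact mul_le_mul h2 h1 (abs_nonneg _) (abs_nonneg _)
    · refine mul_le_mul h3 ?_ (abs_nonneg _) (abs_nonneg _)
      rw [abs_div, abs_of_pos (three_pos (α := ℝ))]
      linarith [abs_nonneg (x - y)]

/-- The solution `ξ` in the strip `[2/3, criticalPoint]` yields the null curve `t = t_c - ξ³ n`,
parametrized by `r`. -/
lemma radiallyNaked_of_lt_rate {μ : ℝ → ℝ} {b δ : ℝ} (hμ : ContinuousOn μ (Icc 0 b))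
    (hδ : 0 < δ) (hδb : δ < b) (hμ0 : 0 < μ 0)
    (hm : ∀ r ∈ Ioc 0 δ, 0 < mass μ r) (hμpos : ∀ r ∈ Ioc 0 δ, 0 < μ r)
    (hq : ∀ r ∈ Ioc 0 δ, criticalRate < focussingRate μ r)
    (hmlim : Tendsto (mass μ) (𝓝[>] 0) (𝓝 0))
    (hTlim : Tendsto (collapseTime μ) (𝓝[>] 0) (𝓝 (centralCollapseTime μ))) :
    RadiallyNaked μ b := by
  obtain ⟨ξ, hξ⟩ := exists_nullField_solution hμ hδb hm hμpos hq
  have hξpos : ∀ r ∈ Ioo 0 δ, 0 < ξ r := fun r hr => by linarith [(hξ r hr).1.1]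
  have hlim : Tendsto (fun r => ξ r ^ 3 * (9 / 4 * mass μ r)) (𝓝[>] 0) (𝓝 0) := by
    have h1 : Tendsto (fun r => criticalPoint ^ 3 * (9 / 4 * mass μ r)) (𝓝[>] 0) (𝓝 0) := by
      simpa using (hmlim.const_mul (9 / 4 : ℝ)).const_mul (criticalPoint ^ 3)
    refine squeeze_zero' ?_ ?_ h1
    · filter_upwards [Ioo_mem_nhdsGT hδ] with r hr
      have := hm r ⟨hr.1, hr.2.le⟩
      have := hξpos r hr
      positivity
    · filter_upwards [Ioo_mem_nhdsGT hδ] with r hr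
      have h2 := hm r ⟨hr.1, hr.2.le⟩
      exact mul_le_mul_of_nonneg_right
        (pow_le_pow_left₀ (hξpos r hr).le (hξ r hr).1.2 3) (by positivity)
  set t : ℝ → ℝ := fun r => collapseTime μ r - ξ r ^ 3 * (9 / 4 * mass μ r) with htdef
  have htlim : Tendsto t (𝓝[>] 0) (𝓝 (centralCollapseTime μ)) := by
    simpa using hTlim.sub hlim
  have ht0 : 0 < centralCollapseTime μ := by unfold centralCollapseTime; positivity
  have hev : ∀ᶠ r in 𝓝[>] (0 : ℝ), r ∈ Ioo 0 δ ∧ 0 < t r := by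
    filter_upwards [Ioo_mem_nhdsGT hδ, htlim.eventually (lt_mem_nhds ht0)] with r h1 h2
      using ⟨h1, h2⟩
  obtain ⟨ε, hε, hsub⟩ := mem_nhdsGT_iff_exists_Ioo_subset.1 hev
  refine ⟨ε, hε, fun r => r, t, ?_, tendsto_id.mono_left nhdsWithin_le_nhds, htlim⟩
  intro r hr
  obtain ⟨hrδ, htr⟩ := hsub hr
  have hrb : r ∈ Ioo 0 b := ⟨hrδ.1, hrδ.2.trans hδb⟩
  have hr0 : 0 < r := hrδ.1
  have hmr := hm r ⟨hrδ.1, hrδ.2.le⟩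
  have hμr := hμpos r ⟨hrδ.1, hrδ.2.le⟩
  have hqr := criticalRate_pos.trans (hq r ⟨hrδ.1, hrδ.2.le⟩)
  have hξr := hξpos r hrδ
  have hyt : collapseTime μ r - t r = ξ r ^ 3 * (9 / 4 * mass μ r) := by rw [htdef]; ring
  have hRr := arealRadiusDr_eq hμ hrb hmr hμr hξr hyt
  have ht : HasDerivAt t (arealRadiusDr μ b r (t r)) r := by
    have h1 := (hasDerivAt_collapseTime hμ hrb hmr hμr).sub
      (((hξ r hrδ).2.pow 3).mul ((hasDerivAt_mass hμ hrb).const_mul (9 / 4 : ℝ)))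
    refine h1.congr_deriv ?_
    rw [hRr]
    unfold nullField
    simp only [Pi.pow_apply]
    push_cast
    field_simp
    ring
  refine ⟨hrb, htr.le, ?_, differentiableAt_id, ht.differentiableAt, ?_, ?_⟩
  · have : 0 < ξ r ^ 3 * (9 / 4 * mass μ r) := by positivity
    linarith
  · rw [ht.deriv, hRr]; positivity
  · rw [ht.deriv, deriv_id'']
    unfold lineElement
    ring

/-! ### Behaviour of the focussing rate at the centre -/

lemma hasDerivWithinAt_iteratedDerivWithin {μ : ℝ → ℝ} {b r : ℝ} (hb : 0 < b)
    (hμ : ContDiffOn ℝ 3 μ (Icc 0 b)) {k : ℕ} (hk : k < 3) (hr : r ∈ Icc 0 b) :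
    HasDerivWithinAt (iteratedDerivWithin k μ (Icc 0 b))
      (iteratedDerivWithin (k + 1) μ (Icc 0 b) r) (Icc 0 b) r := by
  rw [iteratedDerivWithin_succ]
  exact (hμ.differentiableOn_iteratedDerivWithin (by exact_mod_cast hk)
    (uniqueDiffOn_Icc hb) r hr).hasDerivWithinAt

lemma tendsto_iteratedDerivWithin {μ : ℝ → ℝ} {b : ℝ} (hb : 0 < b)
    (hμ : ContDiffOn ℝ 3 μ (Icc 0 b)) {k : ℕ} (hk : k < 3) :
    Tendsto (iteratedDerivWithin k μ (Icc 0 b)) (𝓝[>] 0) (𝓝 (centralDeriv μ b k)) :=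
  (hasDerivWithinAt_iteratedDerivWithin hb hμ hk ⟨le_rfl, hb.le⟩).continuousWithinAt.tendsto
    |>.mono_left (nhdsWithin_le_of_mem (mem_of_superset (Ioo_mem_nhdsGT hb) Ioo_subset_Icc_self))

lemma tendsto_density {μ : ℝ → ℝ} {b : ℝ} (hb : 0 < b) (hμ : ContDiffOn ℝ 3 μ (Icc 0 b)) :
    Tendsto μ (𝓝[>] 0) (𝓝 (μ 0)) := by
  have h := tendsto_iteratedDerivWithin hb hμ (k := 0) (by norm_num)
  simpa [centralDeriv] using h

lemma eventually_hasDerivAt_iteratedDerivWithin {μ : ℝ → ℝ} {b : ℝ} (hb : 0 < b)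
    (hμ : ContDiffOn ℝ 3 μ (Icc 0 b)) {k : ℕ} (hk : k < 3) :
    ∀ᶠ r in 𝓝[>] (0 : ℝ), HasDerivAt (iteratedDerivWithin k μ (Icc 0 b))
      (iteratedDerivWithin (k + 1) μ (Icc 0 b) r) r := by
  filter_upwards [Ioo_mem_nhdsGT hb] with r hr
  exact (hasDerivWithinAt_iteratedDerivWithin hb hμ hk ⟨hr.1.le, hr.2.le⟩).hasDerivAt
    (Icc_mem_nhds hr.1 hr.2)

lemma tendsto_pow_nhdsGT {k : ℕ} (hk : k ≠ 0) :
    Tendsto (fun r : ℝ => r ^ k) (𝓝[>] 0) (𝓝[>] 0) := by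
  refine tendsto_nhdsWithin_iff.2 ⟨?_, ?_⟩
  · have h : Tendsto (fun r : ℝ => r ^ k) (𝓝 0) (𝓝 (0 ^ k)) := (continuous_pow k).tendsto 0
    rw [zero_pow hk] at h
    exact h.mono_left nhdsWithin_le_nhds
  · filter_upwards [self_mem_nhdsWithin] with r hr using pow_pos (mem_Ioi.1 hr) k

lemma tendsto_mass {μ : ℝ → ℝ} {b : ℝ} (hb : 0 < b) (hμ : ContinuousOn μ (Icc 0 b)) :
    Tendsto (mass μ) (𝓝[>] 0) (𝓝 0) := by
  have hc : ContinuousOn (fun x : ℝ => x ^ 2 * μ x) (uIcc 0 b) := by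
    rw [uIcc_of_le hb.le]; fun_prop
  have h0 : mass μ 0 = 0 := intervalIntegral.integral_same
  have h1 : Tendsto (mass μ) (𝓝[uIcc 0 b] 0) (𝓝 (mass μ 0)) :=
    intervalIntegral.continuousOn_primitive_interval (μ := MeasureTheory.volume)
      (hc.integrableOn_compact isCompact_uIcc) 0 left_mem_uIcc
  rw [h0] at h1
  refine h1.mono_left (nhdsWithin_le_of_mem ?_)
  rw [uIcc_of_le hb.le]
  exact mem_of_superset (Ioo_mem_nhdsGT hb) Ioo_subset_Icc_self

/-- The mean density of the ball of radius `r` tends to a multiple of the central density. -/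
lemma tendsto_mass_div {μ : ℝ → ℝ} {b : ℝ} (hb : 0 < b) (hμ : ContDiffOn ℝ 3 μ (Icc 0 b)) :
    Tendsto (fun r => mass μ r / r ^ 3) (𝓝[>] 0) (𝓝 (μ 0 / 3)) := by
  refine HasDerivAt.lhopital_zero_nhdsGT (f' := fun r => r ^ 2 * μ r) (g' := fun r => 3 * r ^ 2)
    ?_ ?_ ?_ (tendsto_mass hb hμ.continuousOn)
    ((tendsto_pow_nhdsGT three_ne_zero).mono_right nhdsWithin_le_nhds) ?_
  · filter_upwards [Ioo_mem_nhdsGT hb] with r hr using hasDerivAt_mass hμ.continuousOn hr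
  · exact Eventually.of_forall fun r => by simpa using hasDerivAt_pow 3 r
  · filter_upwards [self_mem_nhdsWithin] with r hr
    have : 0 < r := hr
    positivity
  · refine ((tendsto_density hb hμ).div_const 3).congr' ?_
    filter_upwards [self_mem_nhdsWithin] with r hr
    have : r ≠ 0 := ne_of_gt hr
    field_simp

lemma tendsto_collapseTime {μ : ℝ → ℝ} {b : ℝ} (hb : 0 < b) (hμ : ContDiffOn ℝ 3 μ (Icc 0 b))
    (hμ0 : 0 < μ 0) :
    Tendsto (collapseTime μ) (𝓝[>] 0) (𝓝 (centralCollapseTime μ)) := by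
  have h1 := (((tendsto_mass_div hb hμ).inv₀ (by positivity)).sqrt).const_mul (2 / 3 : ℝ)
  have h2 : 2 / 3 * Real.sqrt (μ 0 / 3)⁻¹ = centralCollapseTime μ := by
    rw [Real.sqrt_inv]; rfl
  rw [h2] at h1
  refine h1.congr fun r => ?_
  rw [inv_div]; rfl

/-- The excess `3 m - r³ μ` of the mean over the local density vanishes at the centre and has
derivative `-r³ μ'`; its size relative to `r⁶` is therefore that of `-μ'` relative to `6 r²`. -/
lemma tendsto_excess_div {μ : ℝ → ℝ} {b : ℝ} (hb : 0 < b) (hμ : ContDiffOn ℝ 3 μ (Icc 0 b))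
    {l : Filter ℝ}
    (h : Tendsto (fun r => -iteratedDerivWithin 1 μ (Icc 0 b) r / (6 * r ^ 2)) (𝓝[>] 0) l) :
    Tendsto (fun r => (3 * mass μ r - r ^ 3 * μ r) / r ^ 6) (𝓝[>] 0) l := by
  refine HasDerivAt.lhopital_zero_nhdsGT
    (f' := fun r => -(r ^ 3 * iteratedDerivWithin 1 μ (Icc 0 b) r)) (g' := fun r => 6 * r ^ 5)
    ?_ ?_ ?_ ?_ ((tendsto_pow_nhdsGT (by norm_num)).mono_right nhdsWithin_le_nhds) ?_
  · filter_upwards [Ioo_mem_nhdsGT hb,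
      eventually_hasDerivAt_iteratedDerivWithin hb hμ (k := 0) (by norm_num)] with r hr h0
    rw [iteratedDerivWithin_zero] at h0
    refine (((hasDerivAt_mass hμ.continuousOn hr).const_mul 3).sub
      ((hasDerivAt_pow 3 r).mul h0)).congr_deriv ?_
    push_cast
    ring
  · exact Eventually.of_forall fun r => by simpa using hasDerivAt_pow 6 r
  · filter_upwards [self_mem_nhdsWithin] with r hr
    have : 0 < r := hr
    positivity
  · have h1 := (tendsto_mass hb hμ.continuousOn).const_mul 3
    have h2 := ((tendsto_pow_nhdsGT three_ne_zero).mono_right nhdsWithin_le_nhds).mul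
      (tendsto_density hb hμ)
    simpa using h1.sub h2
  · refine h.congr' ?_
    filter_upwards [self_mem_nhdsWithin] with r hr
    have : r ≠ 0 := ne_of_gt hr
    field_simp

/-- If `μ'(0) = 0`, the quotient `μ' / r²` behaves like `μ'' / (2 r)`. -/
lemma tendsto_deriv_div {μ : ℝ → ℝ} {b : ℝ} (hb : 0 < b) (hμ : ContDiffOn ℝ 3 μ (Icc 0 b))
    (h1 : centralDeriv μ b 1 = 0) {l : Filter ℝ}
    (h : Tendsto (fun r => -iteratedDerivWithin 2 μ (Icc 0 b) r / (12 * r)) (𝓝[>] 0) l) :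
    Tendsto (fun r => -iteratedDerivWithin 1 μ (Icc 0 b) r / (6 * r ^ 2)) (𝓝[>] 0) l := by
  refine HasDerivAt.lhopital_zero_nhdsGT (f' := fun r => -iteratedDerivWithin 2 μ (Icc 0 b) r)
    (g' := fun r => 12 * r) ?_ ?_ ?_ ?_ ?_ h
  · filter_upwards [eventually_hasDerivAt_iteratedDerivWithin hb hμ (k := 1) (by norm_num)]
      with r hr using hr.neg
  · exact Eventually.of_forall fun r =>
      ((hasDerivAt_pow 2 r).const_mul 6).congr_deriv (by push_cast; ring)
  · filter_upwards [self_mem_nhdsWithin] with r hr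
    have : 0 < r := hr
    positivity
  · have h2 := (tendsto_iteratedDerivWithin hb hμ (k := 1) (by norm_num)).neg
    rwa [h1, neg_zero] at h2
  · simpa using ((tendsto_pow_nhdsGT two_ne_zero).mono_right nhdsWithin_le_nhds).const_mul (6 : ℝ)

lemma tendsto_neg_div_mul_pow_atTop {g : ℝ → ℝ} {a c : ℝ} {k : ℕ} (hk : k ≠ 0) (hc : 0 < c)
    (hg : Tendsto g (𝓝[>] 0) (𝓝 a)) (ha : a < 0) :
    Tendsto (fun r => -g r / (c * r ^ k)) (𝓝[>] 0) atTop := by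
  have h1 := (hg.neg.div_const c).pos_mul_atTop (div_pos (neg_pos.2 ha) hc)
    (tendsto_inv_nhdsGT_zero.comp (tendsto_pow_nhdsGT hk))
  refine h1.congr fun r => ?_
  simp only [Function.comp_apply]
  rw [← div_eq_mul_inv, div_div]

lemma tendsto_neg_div_mul_pow_atBot {g : ℝ → ℝ} {a c : ℝ} {k : ℕ} (hk : k ≠ 0) (hc : 0 < c)
    (hg : Tendsto g (𝓝[>] 0) (𝓝 a)) (ha : 0 < a) :
    Tendsto (fun r => -g r / (c * r ^ k)) (𝓝[>] 0) atBot := by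
  have h1 := tendsto_neg_div_mul_pow_atTop hk hc hg.neg (neg_lt_zero.2 ha)
  refine (tendsto_neg_atTop_atBot.comp h1).congr fun r => ?_
  simp only [Function.comp_apply]
  ring

lemma tendsto_excess_div_of_vanishing {μ : ℝ → ℝ} {b : ℝ} (hb : 0 < b)
    (hμ : ContDiffOn ℝ 3 μ (Icc 0 b)) (h1 : centralDeriv μ b 1 = 0)
    (h2 : centralDeriv μ b 2 = 0) :
    Tendsto (fun r => (3 * mass μ r - r ^ 3 * μ r) / r ^ 6) (𝓝[>] 0)
      (𝓝 (-centralDeriv μ b 3 / 12)) := by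
  refine tendsto_excess_div hb hμ (tendsto_deriv_div hb hμ h1 ?_)
  have h3 := hasDerivWithinAt_iff_tendsto_slope.1
    (hasDerivWithinAt_iteratedDerivWithin hb hμ (k := 2) (by norm_num) ⟨le_rfl, hb.le⟩)
  have h4 : 𝓝[>] (0 : ℝ) ≤ 𝓝[Icc 0 b \ {0}] 0 := nhdsWithin_le_of_mem
    (mem_of_superset (Ioo_mem_nhdsGT hb) fun r hr => ⟨⟨hr.1.le, hr.2.le⟩, ne_of_gt hr.1⟩)
  refine ((h3.mono_left h4).neg.div_const 12).congr fun r => ?_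
  have h5 : iteratedDerivWithin 2 μ (Icc 0 b) 0 = 0 := h2
  rw [slope_def_field, h5]
  ring

/-- The bounded factor by which the focussing rate differs from `(3 m - r³ μ) / r⁶`. -/
lemma exists_focussingRate_eq_mul {μ : ℝ → ℝ} {b : ℝ} (hb : 0 < b)
    (hμ : ContDiffOn ℝ 3 μ (Icc 0 b)) (hμ0 : 0 < μ 0) :
    ∃ C : ℝ → ℝ, Tendsto C (𝓝[>] 0)
        (𝓝 (4 / 27 * Real.sqrt (μ 0 / 3) / ((μ 0 / 3) ^ 2 * μ 0))) ∧
      ∀ r > 0, focussingRate μ r = C r * ((3 * mass μ r - r ^ 3 * μ r) / r ^ 6) := by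
  refine ⟨fun r => 4 / 27 * Real.sqrt (mass μ r / r ^ 3) / ((mass μ r / r ^ 3) ^ 2 * μ r), ?_, ?_⟩
  · have h := tendsto_mass_div hb hμ
    exact (h.sqrt.const_mul _).div ((h.pow 2).mul (tendsto_density hb hμ)) (by positivity)
  · intro r hr
    have h : (mass μ r / r ^ 3) ^ 2 * μ r * r ^ 6 = mass μ r ^ 2 * μ r := by field_simp
    unfold focussingRate
    rw [div_mul_div_comm, h]

lemma tendsto_focussingRate_atTop {μ : ℝ → ℝ} {b : ℝ} (hb : 0 < b)
    (hμ : ContDiffOn ℝ 3 μ (Icc 0 b)) (hμ0 : 0 < μ 0)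
    (h : Tendsto (fun r => (3 * mass μ r - r ^ 3 * μ r) / r ^ 6) (𝓝[>] 0) atTop) :
    Tendsto (focussingRate μ) (𝓝[>] 0) atTop := by
  obtain ⟨C, hC, hCeq⟩ := exists_focussingRate_eq_mul hb hμ hμ0
  refine (hC.pos_mul_atTop (by positivity) h).congr' ?_
  filter_upwards [self_mem_nhdsWithin] with r hr using (hCeq r hr).symm

lemma tendsto_focussingRate_of_vanishing {μ : ℝ → ℝ} {b : ℝ} (hb : 0 < b)
    (hμ : ContDiffOn ℝ 3 μ (Icc 0 b)) (hμ0 : 0 < μ 0) (h1 : centralDeriv μ b 1 = 0)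
    (h2 : centralDeriv μ b 2 = 0) :
    Tendsto (focussingRate μ) (𝓝[>] 0)
      (𝓝 (-(Real.sqrt 3 / 27) * (centralDeriv μ b 3 / μ 0 ^ (5 / 2 : ℝ)))) := by
  obtain ⟨C, hC, hCeq⟩ := exists_focussingRate_eq_mul hb hμ hμ0
  have h3 := hC.mul (tendsto_excess_div_of_vanishing hb hμ h1 h2)
  have h4 : 4 / 27 * Real.sqrt (μ 0 / 3) / ((μ 0 / 3) ^ 2 * μ 0) * (-centralDeriv μ b 3 / 12) =
      -(Real.sqrt 3 / 27) * (centralDeriv μ b 3 / μ 0 ^ (5 / 2 : ℝ)) := by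
    have h5 : μ 0 ^ (5 / 2 : ℝ) = μ 0 ^ 2 * Real.sqrt (μ 0) := by
      rw [Real.sqrt_eq_rpow, ← Real.rpow_natCast, ← Real.rpow_add hμ0]
      norm_num
    have h6 : Real.sqrt (μ 0) ^ 2 = μ 0 := Real.sq_sqrt hμ0.le
    have h7 : Real.sqrt 3 ^ 2 = 3 := Real.sq_sqrt (by norm_num)
    have h8 : 0 < Real.sqrt (μ 0) := Real.sqrt_pos.2 hμ0
    have h9 : 0 < Real.sqrt 3 := Real.sqrt_pos.2 (by norm_num)
    rw [h5, Real.sqrt_div hμ0.le]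
    field_simp
    rw [h6, h7]
    ring
  rw [h4] at h3
  refine h3.congr' ?_
  filter_upwards [self_mem_nhdsWithin] with r hr using (hCeq r hr).symm

lemma criticalRate_eq : criticalRate = -(Real.sqrt 3 / 27) * criticalRatio := by
  have h : Real.sqrt 3 * Real.sqrt 3 = 3 := Real.mul_self_sqrt (by norm_num)
  unfold criticalRate criticalRatio
  linear_combination (-(52 / 81) : ℝ) * h

lemma lt_criticalRatio_iff {x : ℝ} :
    criticalRate < -(Real.sqrt 3 / 27) * x ↔ x < criticalRatio := by
  have h : 0 < Real.sqrt 3 / 27 := by positivity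
  rw [criticalRate_eq, neg_mul, neg_mul, neg_lt_neg_iff, mul_lt_mul_iff_right₀ h]

lemma criticalRatio_lt_iff {x : ℝ} :
    -(Real.sqrt 3 / 27) * x < criticalRate ↔ criticalRatio < x := by
  have h : 0 < Real.sqrt 3 / 27 := by positivity
  rw [criticalRate_eq, neg_mul, neg_mul, neg_lt_neg_iff, mul_lt_mul_iff_right₀ h]

/-! ### The dichotomy -/

lemma mass_pos {μ : ℝ → ℝ} {b r : ℝ} (hm : StrictMonoOn (mass μ) (Icc 0 b))
    (hr : r ∈ Ioc 0 b) : 0 < mass μ r := by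
  have h := hm ⟨le_rfl, hr.1.le.trans hr.2⟩ ⟨hr.1.le, hr.2⟩ hr.1
  rwa [show mass μ 0 = 0 from intervalIntegral.integral_same] at h

lemma density_zero_pos {μ : ℝ → ℝ} {b : ℝ} (hb : 0 < b) (hμ : ContDiffOn ℝ 3 μ (Icc 0 b))
    (hμ0 : μ 0 ≠ 0) (hm : StrictMonoOn (mass μ) (Icc 0 b)) : 0 < μ 0 := by
  have h : 0 ≤ μ 0 / 3 := by
    refine ge_of_tendsto (tendsto_mass_div hb hμ) ?_
    filter_upwards [Ioo_mem_nhdsGT hb] with r hr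
    exact (div_pos (mass_pos hm ⟨hr.1, hr.2.le⟩) (pow_pos hr.1 3)).le
  exact lt_of_le_of_ne (by linarith) hμ0.symm

lemma NoShellCrossing.excess_pos {μ : ℝ → ℝ} {b r : ℝ} (h : NoShellCrossing μ b)
    (hμ : ContinuousOn μ (Icc 0 b)) (hr : r ∈ Ioo 0 b) : 0 < 3 * mass μ r - r ^ 3 * μ r := by
  have h1 := h r ⟨hr.1, hr.2.le⟩
  rw [derivWithin_of_mem_nhds (Icc_mem_nhds hr.1 hr.2), (hasDerivAt_mass hμ hr).deriv,
    lt_div_iff₀ hr.1] at h1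
  nlinarith

/-- Under the no-shell-crossing condition the first nonzero number among `μ'(0)`, `μ''(0)` cannot
be positive, as it would make `(3 m - r³ μ) / r⁶` tend to `-∞`. -/
lemma not_tendsto_excess_atBot {μ : ℝ → ℝ} {b : ℝ} (hb : 0 < b)
    (hμ : ContinuousOn μ (Icc 0 b)) (hnsc : NoShellCrossing μ b) :
    ¬ Tendsto (fun r => (3 * mass μ r - r ^ 3 * μ r) / r ^ 6) (𝓝[>] 0) atBot := by
  intro h
  obtain ⟨r, h1, h2⟩ := ((h.eventually_lt_atBot 0).and (Ioo_mem_nhdsGT hb)).exists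
  exact absurd h1 (not_lt.2 (div_pos (hnsc.excess_pos hμ h2) (pow_pos h2.1 6)).le)

/-- A property that holds near the centre holds, together with the regularity of the shells, on
some `(0, δ]` inside the cloud. -/
lemma exists_radius {μ : ℝ → ℝ} {b : ℝ} (hb : 0 < b) (hμ : ContDiffOn ℝ 3 μ (Icc 0 b))
    (hμ0 : 0 < μ 0) {P : ℝ → Prop} (hP : ∀ᶠ r in 𝓝[>] (0 : ℝ), P r) :
    ∃ δ, 0 < δ ∧ δ < b ∧ ∀ r ∈ Ioc 0 δ, 0 < μ r ∧ P r := by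
  have hev : ∀ᶠ r in 𝓝[>] (0 : ℝ), r < b ∧ 0 < μ r ∧ P r := by
    filter_upwards [Ioo_mem_nhdsGT hb, (tendsto_density hb hμ).eventually (lt_mem_nhds hμ0), hP]
      with r h1 h2 h3 using ⟨h1.2, h2, h3⟩
  obtain ⟨δ, hδ, hsub⟩ := mem_nhdsGT_iff_exists_Ioc_subset.1 hev
  exact ⟨δ, hδ, (hsub ⟨hδ, le_rfl⟩).1, fun r hr => (hsub hr).2⟩

lemma radiallyNaked_of_eventually {μ : ℝ → ℝ} {b : ℝ} (hb : 0 < b)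
    (hμ : ContDiffOn ℝ 3 μ (Icc 0 b)) (hμ0 : 0 < μ 0) (hm : StrictMonoOn (mass μ) (Icc 0 b))
    (h : ∀ᶠ r in 𝓝[>] (0 : ℝ), criticalRate < focussingRate μ r) : RadiallyNaked μ b := by
  obtain ⟨δ, hδ, hδb, hδP⟩ := exists_radius hb hμ hμ0 h
  exact radiallyNaked_of_lt_rate hμ.continuousOn hδ hδb hμ0
    (fun r hr => mass_pos hm ⟨hr.1, hr.2.trans hδb.le⟩) (fun r hr => (hδP r hr).1)
    (fun r hr => (hδP r hr).2) (tendsto_mass hb hμ.continuousOn) (tendsto_collapseTime hb hμ hμ0)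

lemma radiallyCensored_of_tendsto {μ : ℝ → ℝ} {b q : ℝ} (hb : 0 < b)
    (hμ : ContDiffOn ℝ 3 μ (Icc 0 b)) (hμ0 : 0 < μ 0) (hm : StrictMonoOn (mass μ) (Icc 0 b))
    (hnsc : NoShellCrossing μ b) (h : Tendsto (focussingRate μ) (𝓝[>] 0) (𝓝 q))
    (hq : q < criticalRate) : RadiallyCensored μ b := by
  obtain ⟨q', hqq', hq'⟩ := exists_between hq
  obtain ⟨δ, hδ, hδb, hδP⟩ := exists_radius hb hμ hμ0 (h.eventually (gt_mem_nhds hqq'))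
  refine not_radiallyNaked_of_rate_le (θ := q' / criticalRate) hμ.continuousOn hδ
    ((div_lt_one criticalRate_pos).2 hq')
    (fun r hr => mass_pos hm ⟨hr.1, hr.2.trans hδb.le⟩) (fun r hr => (hδP r hr).1) ?_ ?_
    (tendsto_mass hb hμ.continuousOn) (tendsto_collapseTime hb hμ hμ0)
  · intro r hr
    have h1 := mass_pos hm ⟨hr.1, hr.2.trans hδb.le⟩
    have h2 := (hδP r hr).1
    have h3 := hnsc.excess_pos hμ.continuousOn ⟨hr.1, hr.2.trans_lt hδb⟩
    unfold focussingRate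
    positivity
  · intro r hr
    rw [div_mul_cancel₀ _ criticalRate_pos.ne']
    exact (hδP r hr).2.le

end DustCollapse

theorem theorem1 (b : ℝ) (hb : 0 < b) (μ : ℝ → ℝ)
    (hμ : ContDiffOn ℝ 3 μ (Set.Icc 0 b)) (hμ0 : μ 0 ≠ 0)
    (hm : StrictMonoOn (DustCollapse.mass μ) (Set.Icc 0 b))
    (hnsc : DustCollapse.NoShellCrossing μ b)
    (hborder : ¬ (DustCollapse.centralDeriv μ b 1 = 0 ∧ DustCollapse.centralDeriv μ b 2 = 0 ∧
      DustCollapse.centralDeriv μ b 3 / μ 0 ^ (5 / 2 : ℝ) = DustCollapse.criticalRatio)) :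
    (DustCollapse.RadiallyNaked μ b ↔
      (DustCollapse.centralDeriv μ b 1 < 0 ∨
        (DustCollapse.centralDeriv μ b 1 = 0 ∧ DustCollapse.centralDeriv μ b 2 < 0) ∨
        (DustCollapse.centralDeriv μ b 1 = 0 ∧ DustCollapse.centralDeriv μ b 2 = 0 ∧
          DustCollapse.centralDeriv μ b 3 / μ 0 ^ (5 / 2 : ℝ) < DustCollapse.criticalRatio))) ∧
    (DustCollapse.RadiallyCensored μ b ↔
      (DustCollapse.centralDeriv μ b 1 = 0 ∧ DustCollapse.centralDeriv μ b 2 = 0 ∧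
        DustCollapse.criticalRatio < DustCollapse.centralDeriv μ b 3 / μ 0 ^ (5 / 2 : ℝ))) := by
  open DustCollapse in
  have hμ0' : 0 < μ 0 := density_zero_pos hb hμ hμ0 hm
  have hg1 := tendsto_iteratedDerivWithin hb hμ (k := 1) (by norm_num)
  have hg2 := tendsto_iteratedDerivWithin hb hμ (k := 2) (by norm_num)
  have htop : Tendsto (focussingRate μ) (𝓝[>] 0) atTop → RadiallyNaked μ b := fun h =>
    radiallyNaked_of_eventually hb hμ hμ0' hm (h.eventually_gt_atTop _)
  have hbot := not_tendsto_excess_atBot hb hμ.continuousOn hnsc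
  rcases lt_trichotomy (centralDeriv μ b 1) 0 with h1 | h1 | h1
  · have hN : RadiallyNaked μ b := htop (tendsto_focussingRate_atTop hb hμ hμ0'
      (tendsto_excess_div hb hμ
        (tendsto_neg_div_mul_pow_atTop two_ne_zero (by norm_num) hg1 h1)))
    exact ⟨iff_of_true hN (Or.inl h1), iff_of_false (not_not.2 hN) fun h => h1.ne h.1⟩
  · rcases lt_trichotomy (centralDeriv μ b 2) 0 with h2 | h2 | h2
    · have h3 := tendsto_neg_div_mul_pow_atTop one_ne_zero (c := 12) (by norm_num) hg2 h2
      simp only [pow_one] at h3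
      have hN : RadiallyNaked μ b := htop (tendsto_focussingRate_atTop hb hμ hμ0'
        (tendsto_excess_div hb hμ (tendsto_deriv_div hb hμ h1 h3)))
      exact ⟨iff_of_true hN (Or.inr (Or.inl ⟨h1, h2⟩)),
        iff_of_false (not_not.2 hN) fun h => h2.ne h.2.1⟩
    · have hlim := tendsto_focussingRate_of_vanishing hb hμ hμ0' h1 h2
      rcases lt_trichotomy (centralDeriv μ b 3 / μ 0 ^ (5 / 2 : ℝ)) criticalRatio with h3 | h3 | h3
      · have hN : RadiallyNaked μ b := radiallyNaked_of_eventually hb hμ hμ0' hm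
          (hlim.eventually (lt_mem_nhds (lt_criticalRatio_iff.2 h3)))
        exact ⟨iff_of_true hN (Or.inr (Or.inr ⟨h1, h2, h3⟩)),
          iff_of_false (not_not.2 hN) fun h => h3.not_gt h.2.2⟩
      · exact absurd ⟨h1, h2, h3⟩ hborder
      · have hC : RadiallyCensored μ b := radiallyCensored_of_tendsto hb hμ hμ0' hm hnsc hlim
          (criticalRatio_lt_iff.2 h3)
        refine ⟨iff_of_false hC ?_, iff_of_true hC ⟨h1, h2, h3⟩⟩
        rintro (h | ⟨-, h⟩ | ⟨-, -, h⟩)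
        · exact h.ne h1
        · exact h.ne h2
        · exact h3.not_gt h
    · have h3 := tendsto_neg_div_mul_pow_atBot one_ne_zero (c := 12) (by norm_num) hg2 h2
      simp only [pow_one] at h3
      exact absurd (tendsto_excess_div hb hμ (tendsto_deriv_div hb hμ h1 h3)) hbot
  · exact absurd (tendsto_excess_div hb hμ
      (tendsto_neg_div_mul_pow_atBot two_ne_zero (by norm_num) hg1 h1)) hbot
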